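/- Notation. Let $d\ge 1$. Put $e_n(x)=(2\pi)^{-d/2}e^{i\langle x,n\rangle}$ for $n\in\mathbb Z^d$ (the standard orthonormal basis of $L_2([-\pi,\pi]^d)$), and $C_{\ell,d}=\{-\ell,\dots,\ell\}^d$ for $\ell=1,2,\dots$. Let $\mathrm{SINC}(x)=\prod_{j=1}^d \frac{\sin x(j)}{x(j)}$ (with value $1$ for a factor with $x(j)=0$) and $Q_{d,\ell}(t)=\prod_{j=1}^d\prod_{k=1}^{\ell}\bigl(1-\frac{t(j)^2}{k^2}\bigr)$. The quotient $\mathrm{SINC}(\pi t)/Q_{d,\ell}(t)$ has removable singularities and denotes its continuous extension to $\mathbb R^d$; in each coordinate it is given by $\lim_{x\to n}\frac{\mathrm{sinc}(\pi x)}{Q_{1,\ell}(x)}=\frac{(\ell!)^2}{(\ell+n)!\,(\ell-n)!}$ for integers $|n|\le\ell$. Let $PW_{[-\pi,\pi]^d}$ be the space of all complex-valued $f\in L_2(\mathbb R^d)$ for which the inverse Fourier transform $(2\pi)^{-d/2}\int_{\mathbb R^d} f(t)e^{i\langle\cdot,t\rangle}\,dt$ (in the $L_2$ sense) is supported in $[-\pi,\pi]^d$;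 each $f$ is identified with its continuous representative. A Riesz basis of a Hilbert space is a family that is the image of an orthonormal basis under a bounded linear isomorphism of the space onto itself. A Riesz basis $(f_n)_{n\in\mathbb Z^d}$ of $L_2([-\pi,\pi]^d)$ is called uniformly invertible if, for the isomorphism $L$ with $Le_n=f_n$, the finite matrices $A_\ell=(\langle Le_n,e_m\rangle)_{m,n\in C_{\ell,d}}$ are invertible for all $\ell\ge1$ and $\sup_{\ell\ge 1}\|A_\ell^{-1}\|<\infty$ in the Euclidean operator norm. Theorem 4.1. Let $(t_n)_{n\in\mathbb Z^d}\subset\mathbb R^d$ and $f_n(x)=(2\pi)^{-d/2}e^{i\langle x,t_n\rangle}$, and suppose that $(f_n)_{n\in\mathbb Z^d}$ is a uniformly invertible Riesz basis of $L_2([-\pi,\pi]^d)$. Then for every $f\in PW_{[-\pi,\pi]^d}$ there is a unique sequence $(\Psi_\ell)_{\ell\ge1}$ of polynomials in $d$ variables with complex coefficients such that, for every $\ell\ge1$, (a) $\Psi_\ell$ has degree at most $2\ell$ in each coordinate, and (b) $\Psi_\ell(t_n)=f(t_n)$ for all $n\in C_{\ell,d}$. If $f$ is real-valued on $\mathbb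 R^d$, then so is every $\Psi_\ell$. Moreover, (c) the functions $t\mapsto\Psi_\ell(t)\,\dfrac{\mathrm{SINC}(\pi t)}{Q_{d,\ell}(t)}$ belong to $L_2(\mathbb R^d)$ and converge to $f$ as $\ell\to\infty$, both in $L_2(\mathbb R^d)$ and uniformly on $\mathbb R^d$. -/

import Mathlib

open MeasureTheory Filter Topology
open scoped FourierTransform Matrix.Norms.L2Operator

noncomputable section

namespace ExpInterp

/-! ### Riesz bases and uniform invertibility in a complex Hilbert space -/

section Hilbert

variable {ι H : Type*} [NormedAddCommGroup H] [InnerProductSpace ℂ H]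

/-- A Riesz basis of `H`: a family isomorphically equivalent to an orthonormal basis. -/
def IsRieszBasis (v : ι → H) : Prop :=
  ∃ (b : HilbertBasis ι ℂ H) (T : H ≃L[ℂ] H), ∀ i, T (b i) = v i

/-- The finite matrix of `P L P` with respect to the orthonormal family `(e n)` for `n ∈ S`, where
`P` is the orthogonal projection onto the span of these `e n`. Its entries are `⟨e m, L (e n)⟩`
(the inner product is conjugate linear in its first argument). -/
def truncMatrix (e : ι → H) (L : H ≃L[ℂ] H) (S : Finset ι) : Matrix S S ℂ :=
  Matrix.of fun m n => inner ℂ (e m) (L (e n))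

/-- `L` is uniformly invertible with respect to the projections onto the spans of `(e n)`,
`n ∈ S ℓ`, for `ℓ = 1, 2, …`: all the finite matrices are invertible, and the operator
norms (for the Euclidean norm) of the inverse matrices are bounded. -/
def IsUniformlyInvertible [DecidableEq ι] (e : ι → H) (S : ℕ+ → Finset ι) (L : H ≃L[ℂ] H) :
    Prop :=
  (∀ ℓ, IsUnit (truncMatrix e L (S ℓ))) ∧
    ∃ M : ℝ, ∀ ℓ, ‖(truncMatrix e L (S ℓ))⁻¹‖ ≤ M

/-- A Riesz basis `v` is uniformly invertible with respect to the projections onto the spans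
of `(e n)`, `n ∈ S ℓ`, where `e` is an orthonormal basis: the
corresponding isomorphism `L (e n) = v n` is uniformly invertible. -/
def IsUniformlyInvertibleRieszBasis [DecidableEq ι] (e : ι → H) (S : ℕ+ → Finset ι)
    (v : ι → H) : Prop :=
  IsRieszBasis v ∧
    ∃ L : H ≃L[ℂ] H, (∀ n, L (e n) = v n) ∧ IsUniformlyInvertible e S L

end Hilbert

/-! ### Exponentials in `L₂([-π,π]^d)` -/

/-- The cube `[-π,π]^d`. -/
def cube (d : ℕ) : Set (EuclideanSpace ℝ (Fin d)) :=
  {x | ∀ i, x i ∈ Set.Icc (-Real.pi) Real.pi}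

/-- The Hilbert space `L₂([-π,π]^d)`, with Lebesgue measure. -/
abbrev L2Cube (d : ℕ) : Type :=
  Lp ℂ 2 ((volume : Measure (EuclideanSpace ℝ (Fin d))).restrict (cube d))

/-- The function `x ↦ (2π)^(-d/2) exp(i⟨x,s⟩)`. -/
def expFun (d : ℕ) (s x : EuclideanSpace ℝ (Fin d)) : ℂ :=
  (((2 * Real.pi) ^ (-(d : ℝ) / 2) : ℝ) : ℂ) * Complex.exp (Complex.I * (inner ℝ x s : ℝ))

theorem volume_cube_lt_top (d : ℕ) : volume (cube d) < ⊤ := by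
  have h : Bornology.IsBounded (WithLp.ofLp '' cube d : Set (Fin d → ℝ)) := by
    refine (Metric.isBounded_Icc (fun _ => -Real.pi) (fun _ => Real.pi)).subset ?_
    rintro _ ⟨x, hx, rfl⟩
    exact ⟨fun i => (hx i).1, fun i => (hx i).2⟩
  have h2 : Bornology.IsBounded (cube d) := by
    have := (PiLp.antilipschitzWith_ofLp 2 (fun _ : Fin d => ℝ)).isBounded_preimage h
    exact this.subset (Set.subset_preimage_image _ _)
  exact h2.measure_lt_top

theorem memLp_expFun (d : ℕ) (s : EuclideanSpace ℝ (Fin d)) :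
    MemLp (expFun d s) 2
      ((volume : Measure (EuclideanSpace ℝ (Fin d))).restrict (cube d)) := by
  have : IsFiniteMeasure
      ((volume : Measure (EuclideanSpace ℝ (Fin d))).restrict (cube d)) :=
    ⟨by rw [Measure.restrict_apply_univ]; exact volume_cube_lt_top d⟩
  have hc : Continuous (expFun d s) := by unfold expFun; fun_prop
  refine MemLp.of_bound hc.aestronglyMeasurable ((2 * Real.pi) ^ (-(d : ℝ) / 2))
    (Eventually.of_forall fun x => ?_)
  have hp : (0 : ℝ) ≤ (2 * Real.pi) ^ (-(d : ℝ) / 2) := by positivity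
  rw [expFun, norm_mul, mul_comm Complex.I, Complex.norm_exp_ofReal_mul_I, mul_one,
    Complex.norm_real, Real.norm_of_nonneg hp]

/-- The exponential `(2π)^(-d/2) exp(i⟨·,s⟩)` as an element of `L₂([-π,π]^d)`. -/
def expL2 (d : ℕ) (s : EuclideanSpace ℝ (Fin d)) : L2Cube d := (memLp_expFun d s).toLp

/-- An integer vector as a point of `ℝ^d`. -/
def intVec (d : ℕ) (n : Fin d → ℤ) : EuclideanSpace ℝ (Fin d) :=
  WithLp.toLp 2 fun i => (n i : ℝ)

/-- The index set `{-ℓ,…,ℓ}^d`. -/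
def box (d ℓ : ℕ) : Finset (Fin d → ℤ) :=
  Fintype.piFinset fun _ => Finset.Icc (-(ℓ : ℤ)) ℓ

/-! ### Bandlimited functions -/

/-- The unitary inverse Fourier transform `ξ ↦ (2π)^(-d/2) ∫ f(t) exp(i⟨ξ,t⟩) dt` on `L₂(ℝ^d)`
(a representative). Mathlib's `𝓕⁻` has `exp(2πi⟨ξ,t⟩)` as its kernel. -/
def invFourierL2 (d : ℕ) (f : Lp ℂ 2 (volume : Measure (EuclideanSpace ℝ (Fin d))))
    (ξ : EuclideanSpace ℝ (Fin d)) : ℂ :=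
  (((2 * Real.pi) ^ (-(d : ℝ) / 2) : ℝ) : ℂ) *
    (𝓕⁻ f : Lp ℂ 2 (volume : Measure (EuclideanSpace ℝ (Fin d)))) ((2 * Real.pi)⁻¹ • ξ)

/-- The Paley-Wiener space of `[-π,π]^d`: the square integrable functions on `ℝ^d` whose inverse
Fourier transform is supported in the cube. Every such class has exactly one
continuous representative, and this is the one that is used. -/
def PaleyWiener (d : ℕ) : Set (EuclideanSpace ℝ (Fin d) → ℂ) :=
  {f | Continuous f ∧ ∃ hf : MemLp f 2 volume,
    ∀ᵐ ξ, ξ ∉ cube d → invFourierL2 d hf.toLp ξ = 0}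

/-! ### The functions `SINC` and `Q`, and their quotient -/

/-- `SINC(x) = sinc(x(1)) ⋯ sinc(x(d))`. -/
def SINC (d : ℕ) (x : EuclideanSpace ℝ (Fin d)) : ℝ := ∏ i, Real.sinc (x i)

/-- `Q_{1,ℓ}(x) = ∏_{k=1}^ℓ (1 - x²/k²)`. -/
def Q1 (ℓ : ℕ) (x : ℝ) : ℝ := ∏ k ∈ Finset.Icc 1 ℓ, (1 - x ^ 2 / (k : ℝ) ^ 2)

/-- `Q_{d,ℓ}(t) = Q_{1,ℓ}(t(1)) ⋯ Q_{1,ℓ}(t(d))`. -/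
def Q (d ℓ : ℕ) (t : EuclideanSpace ℝ (Fin d)) : ℝ := ∏ i, Q1 ℓ (t i)

open scoped Nat in
/-- The function `sinc(πx)/Q_{1,ℓ}(x)` with its removable singularities, which are at the integers
`x = ± n`, `1 ≤ n ≤ ℓ`, removed: the value there is the limit `(ℓ!)²/((ℓ+n)!(ℓ-n)!)`. -/
def sincQuot (ℓ : ℕ) (x : ℝ) : ℝ :=
  if Q1 ℓ x = 0 then ((ℓ ! : ℝ)) ^ 2 / (((ℓ + ⌊|x|⌋₊) ! : ℝ) * ((ℓ - ⌊|x|⌋₊) ! : ℝ))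
  else Real.sinc (Real.pi * x) / Q1 ℓ x

/-- The function `SINC(πt)/Q_{d,ℓ}(t)` on `ℝ^d` with its removable singularities removed. -/
def SINCQuot (d ℓ : ℕ) (t : EuclideanSpace ℝ (Fin d)) : ℝ := ∏ i, sincQuot ℓ (t i)

theorem SINCQuot_eq (d ℓ : ℕ) (t : EuclideanSpace ℝ (Fin d)) (h : Q d ℓ t ≠ 0) :
    SINCQuot d ℓ t = SINC d (Real.pi • t) / Q d ℓ t := by
  have h' : ∀ i, Q1 ℓ (t i) ≠ 0 := fun i => (Finset.prod_ne_zero_iff.1 h) i (Finset.mem_univ i)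
  simp [SINCQuot, SINC, Q, sincQuot, h', Finset.prod_div_distrib]

/-! ### Interpolating polynomials -/

/-- The value at a point of `ℝ^d` of a polynomial with complex coefficients. -/
def evalAt {d : ℕ} (p : MvPolynomial (Fin d) ℂ) (t : EuclideanSpace ℝ (Fin d)) : ℂ :=
  MvPolynomial.eval (fun i => (t i : ℂ)) p

/-- For `ℓ = 1, 2, …`, the polynomial `Ψ ℓ` has degree at most `2ℓ` in every coordinate, and it
interpolates `f` at the points `t n` for `n ∈ {-ℓ,…,ℓ}^d`. -/
def Interpolates {d : ℕ} (t : (Fin d → ℤ) → EuclideanSpace ℝ (Fin d))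
    (f : EuclideanSpace ℝ (Fin d) → ℂ) (Ψ : ℕ+ → MvPolynomial (Fin d) ℂ) : Prop :=
  ∀ ℓ : ℕ+, (∀ i, (Ψ ℓ).degreeOf i ≤ 2 * (ℓ : ℕ)) ∧
    ∀ n ∈ box d ℓ, evalAt (Ψ ℓ) (t n) = f (t n)

/-- The approximant `t ↦ Ψ(t) SINC(πt)/Q_{d,ℓ}(t)`. -/
def approximant {d : ℕ} (Ψ : ℕ+ → MvPolynomial (Fin d) ℂ) (ℓ : ℕ+)
    (x : EuclideanSpace ℝ (Fin d)) : ℂ :=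
  evalAt (Ψ ℓ) x * (SINCQuot d ℓ x : ℂ)

end ExpInterp

end

noncomputable section

namespace ExpInterp

/-! ### The quotient of `sinc` and its partial Euler product -/

section SincQuot

open Finset
open scoped Nat

/-! Write `e_s` for `expL2 d s`. Every bandlimited `f` is `s ↦ ⟪e_s, F⟫` for some `F` in `L₂` of the
cube (`exists_eq_inner_expL2`). A Lagrange polynomial on integer nodes times `sincQuot` is a
multiple of a shifted sinc (`eval_lagr_mul_sincQuot`). Hence, for `p` of degree at most `2ℓ` in each
variable, `p · SINCQuot` is `x ↦ ⟪e_x, G⟫` with `G` in the span of the `e_n`, `n` in the box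
(`evalAt_mul_SINCQuot`).

Interpolation of `f` at the `t n` thus implies the finite system `⟪L e_n, G⟫ = SINCQuot (t n) * ⟪L
e_n, F⟫`, whose matrix is the adjoint of the truncated matrix of `L`. Its invertibility gives
uniqueness, and existence follows by counting dimensions.

For convergence, compare `G` with the partial sum `P` of the expansion of `F`. Up to the uniformly
bounded inverses, `G - P` is controlled by `L* (F - P)` and by the coefficients of `L* F` multiplied
by `SINCQuot (t n) - 1`. The latter tend to `0` in `ℓ²` by dominated convergence, because `SINCQuot`
is bounded by `1` and tends to `1` pointwise (`tendsto_sum_of_truncated_systems`). Finally `G → F`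
becomes `L₂` convergence by Plancherel and uniform convergence by Cauchy–Schwarz. -/

theorem Q1_eq_zero_iff {ℓ : ℕ} {x : ℝ} :
    Q1 ℓ x = 0 ↔ ∃ k : ℕ, 1 ≤ k ∧ k ≤ ℓ ∧ |x| = k := by
  rw [Q1, Finset.prod_eq_zero_iff]
  constructor
  · rintro ⟨k, hk, h⟩
    rw [Finset.mem_Icc] at hk
    refine ⟨k, hk.1, hk.2, ?_⟩
    have hk0 : (k : ℝ) ^ 2 ≠ 0 := by
      have : (0 : ℝ) < k := by exact_mod_cast hk.1
      positivity
    have h2 : x ^ 2 = (k : ℝ) ^ 2 := by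
      rw [sub_eq_zero, eq_div_iff hk0, one_mul] at h
      exact h.symm
    rw [← abs_of_nonneg (Nat.cast_nonneg k : (0 : ℝ) ≤ k)]
    exact (sq_eq_sq_iff_abs_eq_abs _ _).1 h2
  · rintro ⟨k, h1, h2, h⟩
    refine ⟨k, Finset.mem_Icc.2 ⟨h1, h2⟩, ?_⟩
    have hk0 : (k : ℝ) ^ 2 ≠ 0 := by
      have : (0 : ℝ) < k := by exact_mod_cast h1
      positivity
    rw [← sq_abs, h, div_self hk0, sub_self]

theorem sincQuot_of_abs_eq {ℓ k : ℕ} {x : ℝ} (hk : k ≤ ℓ) (hx : |x| = k) :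
    sincQuot ℓ x = (ℓ ! : ℝ) ^ 2 / (((ℓ + k) ! : ℝ) * ((ℓ - k) ! : ℝ)) := by
  rw [sincQuot]
  rcases Nat.eq_zero_or_pos k with rfl | h0
  · have hx0 : x = 0 := by simpa using hx
    subst hx0
    have : Q1 ℓ 0 = 1 := by simp [Q1]
    have hf : (ℓ ! : ℝ) ≠ 0 := by positivity
    simp [this]
    field_simp
  · rw [if_pos (Q1_eq_zero_iff.2 ⟨k, h0, hk, hx⟩), hx, Nat.floor_natCast]

/-- Passing from `k` to `k + 1` multiplies the ratio by `(ℓ - k) / (ℓ + k + 1) = 1 - (2k + 1) / (ℓ +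
k + 1)`, which tends to `1`. -/
theorem tendsto_factorial_ratio (k : ℕ) :
    Tendsto (fun ℓ : ℕ => (ℓ ! : ℝ) ^ 2 / (((ℓ + k) ! : ℝ) * ((ℓ - k) ! : ℝ))) atTop (𝓝 1) := by
  induction k with
  | zero =>
    refine tendsto_const_nhds.congr fun ℓ => ?_
    have hf : (ℓ ! : ℝ) ≠ 0 := by positivity
    simp only [add_zero, Nat.sub_zero]
    field_simp
  | succ k ih =>
    have h1 : Tendsto (fun ℓ : ℕ => 1 - (2 * k + 1 : ℝ) / ((ℓ + (k + 1) : ℕ) : ℝ)) atTop (𝓝 1) := by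
      have := (tendsto_natCast_atTop_atTop (R := ℝ)).comp (tendsto_add_atTop_nat (k + 1))
      simpa using (tendsto_const_nhds (x := (1 : ℝ))).sub
        ((tendsto_const_nhds (x := (2 * k + 1 : ℝ))).div_atTop this)
    have h2 := ih.mul h1
    rw [one_mul] at h2
    refine h2.congr' ?_
    filter_upwards [eventually_ge_atTop (k + 1)] with ℓ hℓ
    obtain ⟨j, rfl⟩ := Nat.exists_eq_add_of_le hℓ
    rw [show k + 1 + j - k = j + 1 by omega, show k + 1 + j - (k + 1) = j by omega,
      show k + 1 + j + (k + 1) = (k + 1 + j + k) + 1 by omega, Nat.factorial_succ (k + 1 + j + k),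
      Nat.factorial_succ j]
    have e1 : ((k + 1 + j + k) ! : ℝ) ≠ 0 := by positivity
    have e2 : ((j) ! : ℝ) ≠ 0 := by positivity
    push_cast
    have e3 : (k + 1 + j + k + 1 : ℝ) ≠ 0 := by positivity
    have e4 : (j + 1 : ℝ) ≠ 0 := by positivity
    field_simp
    ring

theorem tendsto_Q1 (x : ℝ) : Tendsto (fun N => Q1 N x) atTop (𝓝 (Real.sinc (Real.pi * x))) := by
  have hQ : ∀ N, Q1 N x = ∏ j ∈ Finset.range N, (1 - x ^ 2 / ((j : ℝ) + 1) ^ 2) := by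
    intro N
    have := Finset.prod_Ico_add' (fun j : ℕ => 1 - x ^ 2 / (j : ℝ) ^ 2) 0 N 1
    push_cast at this
    rw [Q1, Finset.range_eq_Ico, this]
    rfl
  rcases eq_or_ne x 0 with rfl | hx
  · simp [Q1]
  · have hx' : Real.pi * x ≠ 0 := mul_ne_zero Real.pi_ne_zero hx
    have := (Real.tendsto_euler_sin_prod x).div_const (Real.pi * x)
    rw [Real.sinc_of_ne_zero hx']
    refine this.congr fun N => ?_
    rw [hQ, mul_div_cancel_left₀ _ hx']

/-- Off the integers this is Euler's product with a nonzero limit; at an integer the values are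
eventually factorial ratios. -/
theorem tendsto_sincQuot (x : ℝ) : Tendsto (fun ℓ => sincQuot ℓ x) atTop (𝓝 1) := by
  by_cases hx : ∃ k : ℕ, |x| = k
  · obtain ⟨k, hk⟩ := hx
    refine (tendsto_factorial_ratio k).congr' ?_
    filter_upwards [eventually_ge_atTop k] with ℓ hℓ
    rw [sincQuot_of_abs_eq hℓ hk]
  · have h0 : ∀ ℓ, Q1 ℓ x ≠ 0 := fun ℓ h => by
      obtain ⟨k, -, -, h⟩ := Q1_eq_zero_iff.1 h
      exact hx ⟨k, h⟩
    have hs : Real.sinc (Real.pi * x) ≠ 0 := by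
      have hx0 : x ≠ 0 := by rintro rfl; exact hx ⟨0, by simp⟩
      have hx' : Real.pi * x ≠ 0 := mul_ne_zero Real.pi_ne_zero hx0
      rw [Real.sinc_of_ne_zero hx']
      refine div_ne_zero (fun h => hx ?_) hx'
      obtain ⟨n, hn⟩ := Real.sin_eq_zero_iff.1 h
      have : x = n := by
        rw [mul_comm] at hn
        exact (mul_left_cancel₀ Real.pi_ne_zero hn).symm
      exact ⟨n.natAbs, by rw [this, Nat.cast_natAbs, Int.cast_abs]⟩
    have := (tendsto_const_nhds (x := Real.sinc (Real.pi * x))).div (tendsto_Q1 x) hs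
    rw [div_self hs] at this
    refine this.congr fun ℓ => ?_
    simp [sincQuot, h0]

/-- Since `x² ≥ (ℓ + 1) k`, the `k`-th factor has modulus at least `(ℓ + 1 - k) / k`. These bounds
multiply to `1`, as `k ↦ ℓ + 1 - k` permutes `1, …, ℓ`. -/
theorem one_le_abs_Q1 {ℓ : ℕ} {x : ℝ} (hx : (ℓ : ℝ) + 1 ≤ |x|) : 1 ≤ |Q1 ℓ x| := by
  have key : ∀ k ∈ Finset.Icc 1 ℓ, ((ℓ : ℝ) + 1 - k) / k ≤ |1 - x ^ 2 / (k : ℝ) ^ 2| := by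
    intro k hk
    rw [Finset.mem_Icc] at hk
    have h1 : (1 : ℝ) ≤ k := by exact_mod_cast hk.1
    have h2 : (k : ℝ) ≤ ℓ := by exact_mod_cast hk.2
    have h3 : ((ℓ : ℝ) + 1) ^ 2 ≤ x ^ 2 := by
      rw [← sq_abs x]; gcongr
    rw [abs_sub_comm]
    refine le_trans ?_ (le_abs_self _)
    rw [div_le_iff₀ (by positivity), sub_mul, div_mul_eq_mul_div, one_mul, le_sub_iff_add_le,
      le_div_iff₀ (by positivity)]
    have h4 : ((ℓ : ℝ) + 1) * k ≤ x ^ 2 := by nlinarith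
    nlinarith
  rw [Q1, Finset.abs_prod]
  refine le_trans ?_ (Finset.prod_le_prod (fun k hk => ?_) key)
  · rw [Finset.prod_div_distrib]
    have : ∏ k ∈ Finset.Icc 1 ℓ, ((ℓ : ℝ) + 1 - k) = ∏ k ∈ Finset.Icc 1 ℓ, (k : ℝ) := by
      refine Finset.prod_nbij' (fun k => ℓ + 1 - k) (fun k => ℓ + 1 - k) ?_ ?_ ?_ ?_ ?_
      all_goals simp only [Finset.mem_Icc]
      · intro a h; omega
      · intro a h; omega
      · intro a h; omega
      · intro a h; omega
      · intro a h
        rw [Nat.cast_sub (by omega)]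
        push_cast
        ring
    rw [this, div_self]
    refine Finset.prod_ne_zero_iff.2 fun k hk => ?_
    rw [Finset.mem_Icc] at hk
    exact_mod_cast (by omega : k ≠ 0)
  · rw [Finset.mem_Icc] at hk
    have h2 : (k : ℝ) ≤ ℓ := by exact_mod_cast hk.2
    have : 0 ≤ (ℓ : ℝ) + 1 - k := by linarith
    positivity

/-- If `|x| ≤ ℓ + 1`, all later Euler factors lie in `[0, 1]`, so the moduli of the partial products
decrease to the limit. Otherwise `1` separates the two sides. -/
theorem abs_sinc_le_abs_Q1 (ℓ : ℕ) (x : ℝ) : |Real.sinc (Real.pi * x)| ≤ |Q1 ℓ x| := by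
  rcases le_total |x| ((ℓ : ℝ) + 1) with h | h
  · refine le_of_tendsto (tendsto_Q1 x).abs ?_
    filter_upwards [eventually_ge_atTop ℓ] with N hN
    induction N, hN using Nat.le_induction with
    | base => exact le_rfl
    | succ N hN ih =>
      have e : Q1 (N + 1) x = Q1 N x * (1 - x ^ 2 / ((N + 1 : ℕ) : ℝ) ^ 2) := by
        rw [Q1, Finset.prod_Icc_succ_top (by omega)]; rfl
      rw [e, abs_mul]
      refine (mul_le_of_le_one_right (abs_nonneg _) ?_).trans ih
      have h1 : x ^ 2 / ((N + 1 : ℕ) : ℝ) ^ 2 ≤ 1 := by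
        rw [div_le_one (by positivity), ← sq_abs x]
        have : (ℓ : ℝ) ≤ N := by exact_mod_cast hN
        push_cast
        gcongr
        linarith
      have h2 : 0 ≤ x ^ 2 / ((N + 1 : ℕ) : ℝ) ^ 2 := by positivity
      rw [abs_le]
      constructor <;> linarith
  · exact (Real.abs_sinc_le_one _).trans (one_le_abs_Q1 h)

theorem abs_sincQuot_le_one (ℓ : ℕ) (x : ℝ) : |sincQuot ℓ x| ≤ 1 := by
  by_cases h : Q1 ℓ x = 0
  · obtain ⟨k, -, hk, hx⟩ := Q1_eq_zero_iff.1 h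
    rw [sincQuot_of_abs_eq hk hx, abs_of_nonneg (by positivity), div_le_one (by positivity)]
    norm_cast
    obtain ⟨j, rfl⟩ := Nat.exists_eq_add_of_le hk
    rw [Nat.add_sub_cancel_left, sq]
    -- With `ℓ = k + j`, the claim is `ℓ!² ≤ (ℓ + k)! (ℓ - k)!`; the power `(ℓ + 1) ^ k` dominates
    -- `ℓ! / (ℓ - k)!` and is dominated by `(ℓ + k)! / ℓ!`.
    have h1 : (k + j) ! ≤ j ! * (k + j + 1) ^ k := by
      have := Nat.descFactorial_le_pow (k + j) k
      have h3 := Nat.factorial_mul_descFactorial (show k ≤ k + j by omega)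
      rw [Nat.add_sub_cancel_left] at h3
      rw [← h3]
      gcongr
      exact this.trans (Nat.pow_le_pow_left (by omega) _)
    have h2 : (k + j) ! * (k + j + 1) ^ k ≤ (k + j + k) ! := Nat.factorial_mul_pow_le_factorial
    calc (k + j) ! * (k + j) ! ≤ (k + j) ! * (j ! * (k + j + 1) ^ k) := by gcongr
      _ = ((k + j) ! * (k + j + 1) ^ k) * j ! := by ring
      _ ≤ _ := by gcongr
  · rw [sincQuot, if_neg h, abs_div]
    exact div_le_one_of_le₀ (abs_sinc_le_abs_Q1 ℓ x) (abs_nonneg _)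

/-- The Lagrange polynomial at `m` for the nodes `-ℓ, …, ℓ`. -/
def lagr (ℓ : ℕ) (m : ℤ) : Polynomial ℝ :=
  Lagrange.basis (Finset.Icc (-(ℓ : ℤ)) ℓ) (fun k : ℤ => (k : ℝ)) m

theorem natDegree_lagr {ℓ : ℕ} {m : ℤ} (hm : m ∈ Finset.Icc (-(ℓ : ℤ)) ℓ) :
    (lagr ℓ m).natDegree = 2 * ℓ := by
  rw [lagr, Lagrange.natDegree_basis Int.cast_injective.injOn hm]
  simp
  omega

theorem eval_lagr_int {ℓ : ℕ} {m k : ℤ} (hm : m ∈ Finset.Icc (-(ℓ : ℤ)) ℓ)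
    (hk : k ∈ Finset.Icc (-(ℓ : ℤ)) ℓ) : (lagr ℓ m).eval (k : ℝ) = if m = k then 1 else 0 := by
  split_ifs with h
  · subst h
    exact Lagrange.eval_basis_self (v := fun k : ℤ => (k : ℝ)) Int.cast_injective.injOn hm
  · exact Lagrange.eval_basis_of_ne (v := fun k : ℤ => (k : ℝ)) h hk

theorem sinc_pi_mul_int (k : ℤ) : Real.sinc (Real.pi * k) = if k = 0 then 1 else 0 := by
  split_ifs with h
  · simp [h]
  · have : Real.pi * k ≠ 0 := mul_ne_zero Real.pi_ne_zero (by exact_mod_cast h)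
    rw [Real.sinc_of_ne_zero this, mul_comm, Real.sin_int_mul_pi, zero_div]

theorem prod_Ico_sub_self (m : ℤ) (n : ℕ) :
    ∏ j ∈ Finset.Ico (m - n) m, ((m : ℝ) - j) = (n ! : ℝ) := by
  induction n with
  | zero => simp
  | succ n ih =>
    have : Finset.Ico (m - (n + 1 : ℕ)) m = insert (m - (n + 1 : ℕ)) (Finset.Ico (m - n) m) := by
      ext j; simp only [Finset.mem_insert, Finset.mem_Ico]; omega
    rw [this, Finset.prod_insert (by simp only [Finset.mem_Ico]; omega), ih, Nat.factorial_succ]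
    push_cast
    ring

theorem prod_Ioc_sub_self (m : ℤ) (n : ℕ) :
    ∏ j ∈ Finset.Ioc m (m + n), ((m : ℝ) - j) = (-1) ^ n * (n ! : ℝ) := by
  induction n with
  | zero => simp
  | succ n ih =>
    have : Finset.Ioc m (m + (n + 1 : ℕ)) = insert (m + (n + 1 : ℕ)) (Finset.Ioc m (m + n)) := by
      ext j; simp only [Finset.mem_insert, Finset.mem_Ioc]; omega
    rw [this, Finset.prod_insert (by simp), ih, Nat.factorial_succ]
    push_cast
    ring

theorem prod_erase_Icc {ℓ : ℕ} {m : ℤ} (hm : m ∈ Finset.Icc (-(ℓ : ℤ)) ℓ) :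
    ∏ j ∈ (Finset.Icc (-(ℓ : ℤ)) ℓ).erase m, ((m : ℝ) - j) =
      (-1) ^ ℓ * (-1) ^ m.natAbs * (((ℓ + m.natAbs) ! : ℝ) * ((ℓ - m.natAbs) ! : ℝ)) := by
  rw [Finset.mem_Icc] at hm
  obtain ⟨a, ha⟩ : ∃ a : ℕ, m + ℓ = a := ⟨(m + ℓ).toNat, by omega⟩
  obtain ⟨b, hb⟩ : ∃ b : ℕ, (ℓ : ℤ) - m = b := ⟨(ℓ - m).toNat, by omega⟩
  have h : (Finset.Icc (-(ℓ : ℤ)) ℓ).erase m = Finset.Ico (m - a) m ∪ Finset.Ioc m (m + b) := by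
    ext j; simp only [Finset.mem_erase, Finset.mem_union, Finset.mem_Ico, Finset.mem_Icc,
      Finset.mem_Ioc]; omega
  have hd : Disjoint (Finset.Ico (m - a) m) (Finset.Ioc m (m + b)) := by
    rw [Finset.disjoint_left]
    intro j; simp only [Finset.mem_Ico, Finset.mem_Ioc]; omega
  rw [h, Finset.prod_union hd, prod_Ico_sub_self, prod_Ioc_sub_self]
  have hsq : ∀ n : ℕ, ((-1 : ℝ) ^ n) * (-1) ^ n = 1 := fun n => by rw [← mul_pow]; norm_num
  rcases le_total 0 m with h0 | h0
  · have h1 : ℓ + m.natAbs = a := by omega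
    have h2 : ℓ - m.natAbs = b := by omega
    have h3 : ℓ = b + m.natAbs := by omega
    rw [h1, h2, h3, pow_add]
    linear_combination (-(-1 : ℝ) ^ b * (a ! : ℝ) * (b ! : ℝ)) * hsq m.natAbs
  · have h1 : ℓ + m.natAbs = b := by omega
    have h2 : ℓ - m.natAbs = a := by omega
    rw [h1, h2, ← h1, pow_add]
    ring

/-- The nodes `k` and `-k` pair up to `-k² (1 - x²/k²)`, so the nodal polynomial is `x * Q1 ℓ x` up
to a constant. -/
theorem prod_Icc_sub (ℓ : ℕ) (x : ℝ) :
    ∏ j ∈ Finset.Icc (-(ℓ : ℤ)) ℓ, (x - j) = x * ((-1) ^ ℓ * (ℓ ! : ℝ) ^ 2 * Q1 ℓ x) := by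
  induction ℓ with
  | zero => simp [Q1]
  | succ n ih =>
    have : Finset.Icc (-((n + 1 : ℕ) : ℤ)) (n + 1 : ℕ) =
        insert ((n + 1 : ℕ) : ℤ) (insert (-((n + 1 : ℕ) : ℤ)) (Finset.Icc (-(n : ℤ)) n)) := by
      ext j; simp only [Finset.mem_insert, Finset.mem_Icc]; omega
    have e : Q1 (n + 1) x = Q1 n x * (1 - x ^ 2 / ((n + 1 : ℕ) : ℝ) ^ 2) := by
      rw [Q1, Finset.prod_Icc_succ_top (by omega)]; rfl
    rw [this, Finset.prod_insert, Finset.prod_insert, ih, Nat.factorial_succ, e]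
    · push_cast
      have : (n + 1 : ℝ) ≠ 0 := by positivity
      field_simp
      ring
    · simp only [Finset.mem_Icc]; omega
    · simp only [Finset.mem_Icc, Finset.mem_insert]; omega

theorem sincQuot_int_ne_zero {ℓ : ℕ} {m : ℤ} (hm : m ∈ Finset.Icc (-(ℓ : ℤ)) ℓ) :
    sincQuot ℓ m ≠ 0 := by
  have h : |(m : ℝ)| = (m.natAbs : ℕ) := by rw [Nat.cast_natAbs, Int.cast_abs]
  rw [Finset.mem_Icc] at hm
  rw [sincQuot_of_abs_eq (by omega) h]
  positivity

/-- The nodal polynomial cancels the denominator `x * Q1 ℓ x` and leaves a multiple of `sin (π x) /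
(x - m)`, a shifted sinc. At the nodes, where this division is meaningless, both sides are Kronecker
deltas times the same constant. -/
theorem eval_lagr_mul_sincQuot {ℓ : ℕ} {m : ℤ} (hm : m ∈ Finset.Icc (-(ℓ : ℤ)) ℓ) (x : ℝ) :
    (lagr ℓ m).eval x * sincQuot ℓ x = sincQuot ℓ m * Real.sinc (Real.pi * (x - m)) := by
  by_cases hx : ∃ k ∈ Finset.Icc (-(ℓ : ℤ)) ℓ, x = (k : ℝ)
  · obtain ⟨k, hk, rfl⟩ := hx
    rw [eval_lagr_int hm hk, ← Int.cast_sub, sinc_pi_mul_int]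
    by_cases h : m = k
    · subst h; simp
    · have : k - m ≠ 0 := by omega
      simp [h, this]
  · push Not at hx
    have hQ : Q1 ℓ x ≠ 0 := fun h => by
      obtain ⟨k, -, hk, h⟩ := Q1_eq_zero_iff.1 h
      rcases abs_choice x with h' | h' <;> rw [h'] at h
      · exact hx k (by rw [Finset.mem_Icc]; omega) (by simpa using h)
      · exact hx (-k) (by rw [Finset.mem_Icc]; omega) (by push_cast; linarith)
    have hx0 : x ≠ 0 := by simpa using hx 0 (by simp)
    have hxm : x - m ≠ 0 := sub_ne_zero.2 (hx m hm)
    have hpi := Real.pi_ne_zero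
    have hab : |(m : ℝ)| = (m.natAbs : ℕ) := by rw [Nat.cast_natAbs, Int.cast_abs]
    have hm' := Finset.mem_Icc.1 hm
    rw [lagr, Lagrange.eval_basis_not_at_node hm (hx m hm), Lagrange.eval_nodal, prod_Icc_sub,
      Lagrange.nodalWeight, Finset.prod_inv_distrib, prod_erase_Icc hm, sincQuot, if_neg hQ,
      sincQuot_of_abs_eq (by omega) hab, Real.sinc_of_ne_zero (mul_ne_zero hpi hx0),
      Real.sinc_of_ne_zero (mul_ne_zero hpi hxm), mul_sub, mul_comm Real.pi (m : ℝ),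
      Real.sin_sub_int_mul_pi]
    have hs : ((-1 : ℝ) ^ m) = (-1) ^ m.natAbs := by
      rw [← zpow_natCast, ← Int.abs_eq_natAbs]
      rcases abs_choice m with h | h <;> rw [h]
      rw [zpow_neg, ← inv_zpow]; norm_num
    have e1 : ((ℓ + m.natAbs) ! : ℝ) ≠ 0 := by positivity
    have e2 : ((ℓ - m.natAbs) ! : ℝ) ≠ 0 := by positivity
    have hsq : ∀ n : ℕ, ((-1 : ℝ) ^ n) * (-1) ^ n = 1 := fun n => by rw [← mul_pow]; norm_num
    have e3 := hsq ℓ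
    have e4 := hsq m.natAbs
    rw [hs, mul_comm (m : ℝ) Real.pi, ← mul_sub]
    generalize ((-1 : ℝ)) ^ ℓ = r at *
    generalize ((-1 : ℝ)) ^ m.natAbs = s at *
    have hr : r ≠ 0 := left_ne_zero_of_mul_eq_one e3
    have hs0 : s ≠ 0 := left_ne_zero_of_mul_eq_one e4
    field_simp
    rw [sq s, e4, one_mul]

end SincQuot

/-! ### Lagrange interpolation on integer boxes -/

section Grid

variable {d : ℕ}

theorem mem_box {ℓ : ℕ} {n : Fin d → ℤ} :
    n ∈ box d ℓ ↔ ∀ i, n i ∈ Finset.Icc (-(ℓ : ℤ)) ℓ := Fintype.mem_piFinset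

/-- The Lagrange polynomial in `d` variables at `n` for the nodes in the box. -/
def gridLagr (ℓ : ℕ) (n : Fin d → ℤ) : MvPolynomial (Fin d) ℂ :=
  ∏ i, ((lagr ℓ (n i)).map (algebraMap ℝ ℂ)).toMvPolynomial i

theorem degreeOf_toMvPolynomial_le (p : Polynomial ℂ) (i j : Fin d) :
    (p.toMvPolynomial i).degreeOf j ≤ if i = j then p.natDegree else 0 := by
  rw [Polynomial.toMvPolynomial, Polynomial.aeval_eq_sum_range]
  refine (MvPolynomial.degreeOf_sum_le j _ _).trans (Finset.sup_le fun k hk => ?_)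
  rw [MvPolynomial.smul_eq_C_mul]
  refine (MvPolynomial.degreeOf_C_mul_le _ _ _).trans ?_
  split_ifs with h
  · subst h
    rw [MvPolynomial.degreeOf_X_self_pow]
    exact Nat.lt_succ_iff.1 (Finset.mem_range.1 hk)
  · rw [MvPolynomial.degreeOf_X_pow_of_ne k (Ne.symm h)]

theorem degreeOf_gridLagr_le {ℓ : ℕ} {n : Fin d → ℤ} (hn : n ∈ box d ℓ) (j : Fin d) :
    (gridLagr ℓ n).degreeOf j ≤ 2 * ℓ := by
  rw [gridLagr]
  refine (MvPolynomial.degreeOf_prod_le j _ _).trans ?_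
  refine (Finset.sum_le_sum fun i _ => degreeOf_toMvPolynomial_le _ i j).trans ?_
  rw [Finset.sum_ite_eq' Finset.univ j, if_pos (Finset.mem_univ _)]
  exact Polynomial.natDegree_map_le.trans (natDegree_lagr (mem_box.1 hn j)).le

theorem evalAt_gridLagr (ℓ : ℕ) (n : Fin d → ℤ) (x : EuclideanSpace ℝ (Fin d)) :
    evalAt (gridLagr ℓ n) x = ((∏ i, (lagr ℓ (n i)).eval (x i) : ℝ) : ℂ) := by
  rw [evalAt, gridLagr, map_prod, Complex.ofReal_prod]
  refine Finset.prod_congr rfl fun i _ => ?_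
  rw [MvPolynomial.eval_toMvPolynomial, Polynomial.eval_map, ← Complex.coe_algebraMap,
    Polynomial.eval₂_at_apply]

theorem evalAt_gridLagr_intVec {ℓ : ℕ} {n m : Fin d → ℤ} (hn : n ∈ box d ℓ) (hm : m ∈ box d ℓ) :
    evalAt (gridLagr ℓ n) (intVec d m) = if n = m then 1 else 0 := by
  rw [evalAt_gridLagr]
  have : ∀ i, (lagr ℓ (n i)).eval ((intVec d m) i) = if n i = m i then 1 else 0 := fun i =>
    eval_lagr_int (mem_box.1 hn i) (mem_box.1 hm i)
  simp_rw [this]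
  split_ifs with h
  · subst h; simp
  · obtain ⟨i, hi⟩ := Function.ne_iff.1 h
    rw [Finset.prod_eq_zero (Finset.mem_univ i) (if_neg hi), Complex.ofReal_zero]

theorem evalAt_gridLagr_mul_SINCQuot {ℓ : ℕ} {n : Fin d → ℤ} (hn : n ∈ box d ℓ)
    (x : EuclideanSpace ℝ (Fin d)) :
    evalAt (gridLagr ℓ n) x * (SINCQuot d ℓ x : ℂ) =
      ((SINCQuot d ℓ (intVec d n) * ∏ i, Real.sinc (Real.pi * (x i - n i)) : ℝ) : ℂ) := by
  rw [evalAt_gridLagr, ← Complex.ofReal_mul, SINCQuot, SINCQuot, ← Finset.prod_mul_distrib,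
    ← Finset.prod_mul_distrib]
  congr 1
  exact Finset.prod_congr rfl fun i _ => eval_lagr_mul_sincQuot (mem_box.1 hn i) (x i)

theorem SINCQuot_intVec_ne_zero {ℓ : ℕ} {n : Fin d → ℤ} (hn : n ∈ box d ℓ) :
    SINCQuot d ℓ (intVec d n) ≠ 0 :=
  Finset.prod_ne_zero_iff.2 fun i _ => sincQuot_int_ne_zero (mem_box.1 hn i)

theorem abs_SINCQuot_le_one (ℓ : ℕ) (x : EuclideanSpace ℝ (Fin d)) : |SINCQuot d ℓ x| ≤ 1 := by
  rw [SINCQuot, Finset.abs_prod]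
  exact Finset.prod_le_one (fun _ _ => abs_nonneg _) fun i _ => abs_sincQuot_le_one ℓ _

theorem tendsto_SINCQuot (x : EuclideanSpace ℝ (Fin d)) :
    Tendsto (fun ℓ => SINCQuot d ℓ x) atTop (𝓝 1) := by
  simpa [SINCQuot] using tendsto_finsetProd Finset.univ fun i _ => tendsto_sincQuot (x i)

/-- A polynomial of degree at most `2ℓ` in each variable is the interpolant of its values at
the integer points of the box. -/
theorem eq_sum_gridLagr {ℓ : ℕ} {p : MvPolynomial (Fin d) ℂ} (hp : ∀ i, p.degreeOf i ≤ 2 * ℓ) :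
    p = ∑ n ∈ box d ℓ, MvPolynomial.C (evalAt p (intVec d n)) * gridLagr ℓ n := by
  rw [← sub_eq_zero]
  -- The difference vanishes on a product grid with `2ℓ + 1` points per coordinate, more than its
  -- degree in any variable.
  refine MvPolynomial.eq_zero_of_eval_zero_at_prod_finset _
    (fun _ => (Finset.Icc (-(ℓ : ℤ)) ℓ).image fun k : ℤ => (k : ℂ)) (fun i => ?_) fun x hx => ?_
  · rw [Finset.card_image_of_injective _ Int.cast_injective]
    refine lt_of_le_of_lt (MvPolynomial.degreeOf_sub_le i _ _) ?_
    have : (Finset.Icc (-(ℓ : ℤ)) ℓ).card = 2 * ℓ + 1 := by simp; omega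
    rw [this, Nat.lt_succ_iff]
    refine max_le (hp i) ((MvPolynomial.degreeOf_sum_le i _ _).trans (Finset.sup_le fun n hn => ?_))
    exact (MvPolynomial.degreeOf_C_mul_le _ _ _).trans (degreeOf_gridLagr_le hn i)
  · choose m hm hmx using fun i => Finset.mem_image.1 (hx i)
    have hmb : m ∈ box d ℓ := mem_box.2 hm
    have hx' : x = fun i => ((intVec d m i : ℝ) : ℂ) := by
      funext i; rw [← hmx i]; simp [intVec]
    have e : ∀ q : MvPolynomial (Fin d) ℂ, MvPolynomial.eval x q = evalAt q (intVec d m) :=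
      fun q => by rw [hx', evalAt]
    rw [map_sub, map_sum, Finset.sum_eq_single_of_mem m hmb]
    · rw [map_mul, MvPolynomial.eval_C, e, e, evalAt_gridLagr_intVec hmb hmb]
      simp
    · intro n hn hnm
      rw [map_mul, e (gridLagr ℓ n), evalAt_gridLagr_intVec hn hmb, if_neg hnm, mul_zero]

end Grid

/-! ### Inner products of exponentials -/

section Exponentials

variable {d : ℕ}

instance isFiniteMeasure_cube (d : ℕ) :
    IsFiniteMeasure ((volume : Measure (EuclideanSpace ℝ (Fin d))).restrict (cube d)) :=
  ⟨by rw [Measure.restrict_apply_univ]; exact volume_cube_lt_top d⟩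

theorem measurableSet_cube (d : ℕ) : MeasurableSet (cube d) := by
  have : cube d = ⋂ i, (fun x : EuclideanSpace ℝ (Fin d) => x i) ⁻¹' Set.Icc (-Real.pi) Real.pi := by
    ext x; simp [cube]
  rw [this]
  refine MeasurableSet.iInter fun i => ?_
  exact measurableSet_Icc.preimage (by fun_prop : Continuous fun x : EuclideanSpace ℝ (Fin d) => x i).measurable

theorem integral_exp_mul_I (a : ℝ) :
    ∫ x in Set.Icc (-Real.pi) Real.pi, Complex.exp (Complex.I * (x * a : ℝ)) =
      ((2 * Real.pi * Real.sinc (Real.pi * a) : ℝ) : ℂ) := by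
  rw [integral_Icc_eq_integral_Ioc, ← intervalIntegral.integral_of_le (by linarith [Real.pi_pos])]
  rcases eq_or_ne a 0 with rfl | ha
  · simp; ring
  · have hc : Complex.I * (a : ℂ) ≠ 0 := mul_ne_zero Complex.I_ne_zero (by exact_mod_cast ha)
    have h := integral_exp_mul_complex (a := -Real.pi) (b := Real.pi) hc
    have h2 : Real.pi * a ≠ 0 := mul_ne_zero Real.pi_ne_zero ha
    rw [Real.sinc_of_ne_zero h2]
    have e : ∀ x : ℝ, Complex.I * ((x * a : ℝ) : ℂ) = Complex.I * a * x := fun x => by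
      push_cast; ring
    simp_rw [e]
    rw [h, show Complex.I * a * ((Real.pi : ℝ) : ℂ) = (((Real.pi * a : ℝ)) : ℂ) * Complex.I by push_cast; ring,
      show Complex.I * a * ((-Real.pi : ℝ) : ℂ) = -(((Real.pi * a : ℝ)) : ℂ) * Complex.I by push_cast; ring,
      Complex.exp_mul_I, Complex.exp_mul_I, Complex.cos_neg, Complex.sin_neg]
    have h3 : (a : ℂ) ≠ 0 := by exact_mod_cast ha
    have h4 : (Real.pi : ℂ) ≠ 0 := by exact_mod_cast Real.pi_ne_zero
    have h5 := Complex.I_ne_zero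
    push_cast
    field_simp
    ring

theorem inner_expL2_eq_integral (s : EuclideanSpace ℝ (Fin d)) (G : L2Cube d) :
    inner ℂ (expL2 d s) G = ∫ x in cube d, (starRingEnd ℂ) (expFun d s x) * G x := by
  rw [L2.inner_def]
  refine integral_congr_ae ?_
  filter_upwards [(memLp_expFun d s).coeFn_toLp] with x hx
  rw [expL2, hx, RCLike.inner_apply, mul_comm]

theorem conj_expFun (s x : EuclideanSpace ℝ (Fin d)) :
    (starRingEnd ℂ) (expFun d s x) = expFun d (-s) x := by
  rw [expFun, expFun, map_mul, Complex.conj_ofReal, ← Complex.exp_conj, map_mul, Complex.conj_I,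
    Complex.conj_ofReal, inner_neg_right]
  push_cast
  ring_nf

theorem integral_cube_prod (g : Fin d → ℝ → ℂ) :
    ∫ x in cube d, ∏ i, g i (x i) = ∏ i, ∫ x in Set.Icc (-Real.pi) Real.pi, g i x := by
  have h := (PiLp.volume_preserving_ofLp (Fin d)).setIntegral_preimage_emb
    (MeasurableEquiv.toLp 2 (Fin d → ℝ)).symm.measurableEmbedding
    (fun x => ∏ i, g i (x i)) (Set.univ.pi fun _ => Set.Icc (-Real.pi) Real.pi)
  have hc : cube d = (@WithLp.ofLp 2 (Fin d → ℝ)) ⁻¹'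
      (Set.univ.pi fun _ => Set.Icc (-Real.pi) Real.pi) := by
    ext x; simp only [cube, Set.mem_preimage, Set.mem_univ_pi]; rfl
  rw [hc, h, volume_pi, Measure.restrict_pi_pi, integral_fintype_prod_eq_prod]

/-- By Fubini the integral splits into one-dimensional ones, each `2π` times a sinc. This yields
both the orthonormality at integer points and the link with the shifted sincs of the Lagrange
formula. -/
theorem inner_expL2_expL2 (s t : EuclideanSpace ℝ (Fin d)) :
    inner ℂ (expL2 d s) (expL2 d t) = ((∏ i, Real.sinc (Real.pi * (s i - t i)) : ℝ) : ℂ) := by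
  rw [inner_expL2_eq_integral]
  have hp : (((2 * Real.pi) ^ (-(d : ℝ) / 2) : ℝ) : ℂ) * (((2 * Real.pi) ^ (-(d : ℝ) / 2) : ℝ) : ℂ) =
      ((2 * Real.pi) ^ d : ℝ)⁻¹ := by
    rw [← Complex.ofReal_mul, ← Real.rpow_add (by positivity), ← Real.rpow_natCast,
      ← Real.rpow_neg (by positivity)]
    congr 2; ring
  have e : ∀ᵐ x ∂(volume.restrict (cube d)), (starRingEnd ℂ) (expFun d s x) * expL2 d t x =
      (((2 * Real.pi) ^ d : ℝ)⁻¹ : ℂ) * ∏ i, Complex.exp (Complex.I * (x i * (t i - s i) : ℝ)) := by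
    filter_upwards [(memLp_expFun d t).coeFn_toLp] with x hx
    rw [expL2, hx, conj_expFun, expFun, expFun, ← Complex.exp_sum, mul_mul_mul_comm, hp,
      ← Complex.exp_add, ← mul_add, ← Complex.ofReal_add, ← inner_add_right, ← Finset.mul_sum,
      PiLp.inner_apply, Complex.ofReal_inv, Complex.ofReal_sum]
    congr 3
    refine Finset.sum_congr rfl fun i _ => ?_
    congr 1
    simp
    ring
  rw [integral_congr_ae e, integral_const_mul,
    integral_cube_prod (fun i x => Complex.exp (Complex.I * (x * (t i - s i) : ℝ)))]
  simp_rw [integral_exp_mul_I]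
  rw [← Complex.ofReal_prod, Finset.prod_mul_distrib, Finset.prod_const, Finset.card_univ,
    Fintype.card_fin, ← Complex.ofReal_inv, ← Complex.ofReal_mul, inv_mul_cancel_left₀ (by positivity)]
  congr 1
  refine Finset.prod_congr rfl fun i _ => ?_
  rw [← Real.sinc_neg]
  ring_nf

theorem norm_expL2 (s : EuclideanSpace ℝ (Fin d)) : ‖expL2 d s‖ = 1 := by
  have h : ‖expL2 d s‖ ^ 2 = 1 := by
    rw [norm_sq_eq_re_inner (𝕜 := ℂ), inner_expL2_expL2]
    simp
  exact (pow_eq_one_iff_of_nonneg (norm_nonneg _) two_ne_zero).1 h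

theorem orthonormal_expL2_intVec (d : ℕ) : Orthonormal ℂ fun n => expL2 d (intVec d n) := by
  refine ⟨fun n => norm_expL2 _, fun n m hnm => ?_⟩
  obtain ⟨i, hi⟩ := Function.ne_iff.1 hnm
  rw [inner_expL2_expL2, Finset.prod_eq_zero (Finset.mem_univ i), Complex.ofReal_zero]
  have := sinc_pi_mul_int (n i - m i)
  rw [if_neg (sub_ne_zero.2 hi), Int.cast_sub] at this
  exact this

end Exponentials

/-! ### The Fourier transform on `L₁ ∩ L₂` -/

section Fourier

open scoped SchwartzMap ContDiff

variable {V : Type*} [NormedAddCommGroup V] [InnerProductSpace ℝ V] [FiniteDimensional ℝ V]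
  [MeasurableSpace V] [BorelSpace V]

theorem continuous_fourier {h : V → ℂ} (hi : Integrable h) : Continuous (𝓕 h) :=
  VectorFourier.fourierIntegral_continuous Real.continuous_fourierChar
    (by exact continuous_inner) hi

/-- The Fourier transform of an integrable function in `L₂` is given by the Fourier integral. -/
theorem fourier_Lp_ae_eq (h : Lp ℂ 2 (volume : Measure V)) (hi : Integrable h) :
    ((𝓕 h : Lp ℂ 2 (volume : Measure V)) : V → ℂ) =ᵐ[volume] 𝓕 (h : V → ℂ) := by
  -- Both sides are tested against smooth compactly supported functions: in either sense, the
  -- Fourier transform can be moved onto the test function.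
  refine ae_eq_of_integral_contDiff_smul_eq
    ((Lp.memLp _).locallyIntegrable (by norm_num)) (continuous_fourier hi).locallyIntegrable
    fun g hg hgc => ?_
  have hg₁ : HasCompactSupport (Complex.ofRealCLM ∘ g) := hgc.comp_left rfl
  have hg₂ : ContDiff ℝ ∞ (Complex.ofRealCLM ∘ g) := by fun_prop
  set φ : 𝓢(V, ℂ) := hg₁.toSchwartzMap hg₂ with hφ
  have e : ∀ u : V → ℂ, ∫ x, g x • u x = ∫ x, φ x • u x := fun u => by simp [hφ]
  rw [e, e, ← Lp.toTemperedDistribution_apply, ← Lp.fourier_toTemperedDistribution_eq,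
    TemperedDistribution.fourier_apply, Lp.toTemperedDistribution_apply]
  have h2 := VectorFourier.integral_fourierIntegral_smul_eq_flip (L := innerₗ V)
    Real.continuous_fourierChar (by exact continuous_inner) φ.integrable (μ := volume) hi
  simpa using! h2

theorem quasiMeasurePreserving_smul {c : ℝ} (hc : c ≠ 0) :
    Measure.QuasiMeasurePreserving (fun x : V => c • x) volume volume :=
  ⟨measurable_const_smul c, by
    rw [Measure.map_addHaar_smul _ hc]
    exact Measure.smul_absolutelyContinuous⟩

theorem eLpNorm_comp_smul {c : ℝ} (hc : c ≠ 0) {u : V → ℂ}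
    (hu : AEStronglyMeasurable u volume) :
    eLpNorm (fun x => u (c • x)) 2 volume =
      ENNReal.ofReal |(c ^ Module.finrank ℝ V)⁻¹| ^ (1 / 2 : ℝ) * eLpNorm u 2 volume := by
  have hm : Measure.map (fun x : V => c • x) volume =
      ENNReal.ofReal |(c ^ Module.finrank ℝ V)⁻¹| • volume := Measure.map_addHaar_smul _ hc
  have h := eLpNorm_map_measure (p := 2) (μ := (volume : Measure V)) (f := fun x : V => c • x)
    (g := u) (hu.mono_ac (quasiMeasurePreserving_smul hc).absolutelyContinuous)
    (measurable_const_smul c).aemeasurable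
  rw [hm, eLpNorm_smul_measure_of_ne_top (by norm_num)] at h
  rw [show (fun x => u (c • x)) = u ∘ fun x : V => c • x from rfl, ← h]
  simp

theorem memLp_comp_smul {c : ℝ} (hc : c ≠ 0) {u : V → ℂ} (hu : MemLp u 2 volume) :
    MemLp (fun x => u (c • x)) 2 volume := by
  refine ⟨hu.1.comp_quasiMeasurePreserving (quasiMeasurePreserving_smul hc), ?_⟩
  rw [eLpNorm_comp_smul hc hu.1]
  exact ENNReal.mul_lt_top (ENNReal.rpow_lt_top_of_nonneg (by norm_num) ENNReal.ofReal_ne_top) hu.2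

end Fourier

/-! ### Bandlimited functions as inner products with exponentials -/

section Bandlimited

variable {d : ℕ}

theorem two_pi_ne_zero : 2 * Real.pi ≠ 0 := by positivity

theorem expFun_neg_smul (s η : EuclideanSpace ℝ (Fin d)) :
    expFun d (-s) ((2 * Real.pi) • η) =
      (((2 * Real.pi) ^ (-(d : ℝ) / 2) : ℝ) : ℂ) * (Real.fourierChar (-inner ℝ η s) : ℂ) := by
  rw [expFun, Real.fourierChar_apply, inner_smul_left, inner_neg_right]
  congr 2
  simp
  ring

/-- The function on `ℝ^d` whose Fourier integral is `t ↦ ⟪e_t, G⟫`. -/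
def spectralFun (G : L2Cube d) (η : EuclideanSpace ℝ (Fin d)) : ℂ :=
  (((2 * Real.pi) ^ ((d : ℝ) / 2) : ℝ) : ℂ) * (cube d).indicator G ((2 * Real.pi) • η)

theorem memLp_indicator_cube (G : L2Cube d) : MemLp ((cube d).indicator G) 2 volume :=
  (memLp_indicator_iff_restrict (measurableSet_cube d)).2 (Lp.memLp G)

theorem memLp_spectralFun (G : L2Cube d) : MemLp (spectralFun G) 2 volume :=
  (memLp_comp_smul two_pi_ne_zero (memLp_indicator_cube G)).const_mul _

/-- Together with Plancherel this bounds `G ↦ ⟪e_s, G⟫` from `L₂` of the cube to `L₂(ℝ^d)`. Only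
finiteness of `K` matters for convergence, so the isometry constant is not computed. -/
theorem exists_eLpNorm_spectralFun_le (d : ℕ) :
    ∃ K : ENNReal, K ≠ ⊤ ∧ ∀ G : L2Cube d, eLpNorm (spectralFun G) 2 volume ≤ K * ‖G‖ₑ := by
  refine ⟨‖(((2 * Real.pi) ^ ((d : ℝ) / 2) : ℝ) : ℂ)‖ₑ *
    ENNReal.ofReal |((2 * Real.pi) ^ Module.finrank ℝ (EuclideanSpace ℝ (Fin d)))⁻¹| ^
      (1 / 2 : ℝ), ?_, fun G => ?_⟩
  rotate_left
  · unfold spectralFun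
    refine (eLpNorm_const_smul_le (c := (((2 * Real.pi) ^ ((d : ℝ) / 2) : ℝ) : ℂ))).trans ?_
    rw [eLpNorm_comp_smul two_pi_ne_zero (memLp_indicator_cube G).1,
      eLpNorm_indicator_eq_eLpNorm_restrict (measurableSet_cube d), ← Lp.enorm_def, mul_assoc]
  · exact ENNReal.mul_ne_top enorm_ne_top
      (ENNReal.rpow_lt_top_of_nonneg (by norm_num) ENNReal.ofReal_ne_top).ne

theorem integrable_spectralFun (G : L2Cube d) : Integrable (spectralFun G) := by
  have h : Integrable ((cube d).indicator G) volume :=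
    (integrable_indicator_iff (measurableSet_cube d)).2 ((Lp.memLp G).integrable (by norm_num))
  exact (h.comp_smul two_pi_ne_zero).const_mul _

theorem fourier_spectralFun (G : L2Cube d) (s : EuclideanSpace ℝ (Fin d)) :
    𝓕 (spectralFun G) s = inner ℂ (expL2 d s) G := by
  rw [inner_expL2_eq_integral, Real.fourier_eq]
  have hp : (((2 * Real.pi) ^ (d : ℝ) : ℝ) : ℂ) * (((2 * Real.pi) ^ (-(d : ℝ) / 2) : ℝ) : ℂ) =
      (((2 * Real.pi) ^ ((d : ℝ) / 2) : ℝ) : ℂ) := by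
    rw [← Complex.ofReal_mul, ← Real.rpow_add (by positivity)]
    congr 2; ring
  have e : ∀ η, Real.fourierChar (-inner ℝ η s) • spectralFun G η =
      (((2 * Real.pi) ^ (d : ℝ) : ℝ) : ℂ) * (fun ξ => expFun d (-s) ξ * (cube d).indicator G ξ) ((2 * Real.pi) • η) := by
    intro η
    simp only
    rw [expFun_neg_smul, spectralFun, Circle.smul_def, smul_eq_mul, ← hp]
    ring
  rw [integral_congr_ae (Eventually.of_forall e), integral_const_mul,
    Measure.integral_comp_smul volume (fun ξ => expFun d (-s) ξ * (cube d).indicator G ξ), finrank_euclideanSpace_fin,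
    ← integral_indicator (measurableSet_cube d), abs_of_nonneg (by positivity), Complex.real_smul,
    ← mul_assoc, ← Complex.ofReal_mul, Real.rpow_natCast, mul_inv_cancel₀ (by positivity),
    Complex.ofReal_one, one_mul]
  congr 1
  ext ξ
  by_cases h : ξ ∈ cube d <;> simp [h, conj_expFun]

theorem fourier_spectralFun_toLp_ae_eq (G : L2Cube d) :
    ((𝓕 (memLp_spectralFun G).toLp : Lp ℂ 2 (volume : Measure (EuclideanSpace ℝ (Fin d)))) :
      EuclideanSpace ℝ (Fin d) → ℂ) =ᵐ[volume] fun s => inner ℂ (expL2 d s) G := by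
  have h := (memLp_spectralFun G).coeFn_toLp
  refine (fourier_Lp_ae_eq _ ((integrable_congr h).2 (integrable_spectralFun G))).trans ?_
  refine Eventually.of_forall fun s => ?_
  rw [Real.fourier_congr_ae h, fourier_spectralFun]

theorem memLp_inner_expL2 (G : L2Cube d) : MemLp (fun s => inner ℂ (expL2 d s) G) 2 volume :=
  (memLp_congr_ae (fourier_spectralFun_toLp_ae_eq G)).1 (Lp.memLp _)

theorem eLpNorm_inner_expL2 (G : L2Cube d) :
    eLpNorm (fun s => inner ℂ (expL2 d s) G) 2 volume = eLpNorm (spectralFun G) 2 volume := by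
  rw [← eLpNorm_congr_ae (fourier_spectralFun_toLp_ae_eq G),
    ← eLpNorm_congr_ae (memLp_spectralFun G).coeFn_toLp, ← Lp.enorm_def, ← Lp.enorm_def,
    ← ofReal_norm, ← ofReal_norm, Lp.norm_fourier_eq]

theorem continuous_inner_expL2 (G : L2Cube d) : Continuous fun s => inner ℂ (expL2 d s) G := by
  simp_rw [← fourier_spectralFun]
  exact continuous_fourier (integrable_spectralFun G)

/-- A bandlimited function is given by its inner products with the exponentials. -/
theorem exists_eq_inner_expL2 {f : EuclideanSpace ℝ (Fin d) → ℂ} (hf : f ∈ PaleyWiener d) :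
    ∃ F : L2Cube d, ∀ s, f s = inner ℂ (expL2 d s) F := by
  obtain ⟨hc, hf2, hsupp⟩ := hf
  set h : Lp ℂ 2 (volume : Measure (EuclideanSpace ℝ (Fin d))) := 𝓕⁻ hf2.toLp with hh
  have hG : MemLp (invFourierL2 d hf2.toLp) 2 volume :=
    (memLp_comp_smul (inv_ne_zero two_pi_ne_zero) (Lp.memLp h)).const_mul _
  have hGc := (hG.restrict (cube d)).coeFn_toLp
  refine ⟨(hG.restrict (cube d)).toLp, ?_⟩
  -- The support condition makes the cutoff to the cube harmless, and the two dilations and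
  -- normalizing powers of `2π` cancel.
  have hsp : spectralFun (hG.restrict (cube d)).toLp =ᵐ[volume] h := by
    have h1 : (cube d).indicator (hG.restrict (cube d)).toLp =ᵐ[volume]
        invFourierL2 d hf2.toLp := by
      filter_upwards [hsupp, (ae_restrict_iff' (measurableSet_cube d)).1 hGc] with ξ h1 h2
      by_cases hξ : ξ ∈ cube d
      · rw [Set.indicator_of_mem hξ, h2 hξ]
      · rw [Set.indicator_of_notMem hξ, h1 hξ]
    filter_upwards [(quasiMeasurePreserving_smul two_pi_ne_zero).ae h1] with η hη
    rw [spectralFun, hη, invFourierL2, inv_smul_smul₀ two_pi_ne_zero, ← mul_assoc,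
      ← Complex.ofReal_mul, ← Real.rpow_add (by positivity)]
    rw [show (d : ℝ) / 2 + -d / 2 = 0 by ring, Real.rpow_zero, Complex.ofReal_one, one_mul]
  -- Fourier inversion gives equality almost everywhere; continuity of both sides then makes it hold
  -- at every point.
  have key : f =ᵐ[volume] fun s => inner ℂ (expL2 d s) (hG.restrict (cube d)).toLp := by
    refine hf2.coeFn_toLp.symm.trans ((fourier_spectralFun_toLp_ae_eq _).symm.trans ?_).symm
    have : (memLp_spectralFun (hG.restrict (cube d)).toLp).toLp = h :=
      Lp.ext ((memLp_spectralFun _).coeFn_toLp.trans hsp)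
    rw [this, hh, FourierTransform.fourier_fourierInv_eq]
  exact congrFun ((Continuous.ae_eq_iff_eq _ hc (continuous_inner_expL2 _)).1 key)

end Bandlimited

/-! ### Truncated systems in a Hilbert space -/

section Truncation

variable {ι H : Type*} [NormedAddCommGroup H] [InnerProductSpace ℂ H]

theorem conjTranspose_truncMatrix_mulVec (e : ι → H) (L : H ≃L[ℂ] H) (S : Finset ι) (c : ι → ℂ)
    (n : S) :
    ((truncMatrix e L S).conjTranspose.mulVec fun m => c m) n =
      inner ℂ (L (e n)) (∑ m ∈ S, c m • e m) := by
  rw [inner_sum, ← Finset.sum_coe_sort S, Matrix.mulVec, dotProduct]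
  refine Finset.sum_congr rfl fun m _ => ?_
  rw [inner_smul_right, Matrix.conjTranspose_apply, truncMatrix, Matrix.of_apply,
    ← starRingEnd_apply, inner_conj_symm, mul_comm]

/-- Testing against `L (e n)` applies the adjoint of the truncated matrix to the coefficients, and
the inverse of the adjoint has the same norm as the inverse. -/
theorem norm_le_of_norm_inv_truncMatrix_le [DecidableEq ι] {e : ι → H} {L : H ≃L[ℂ] H} {S : Finset ι}
    (hA : IsUnit (truncMatrix e L S)) {M : ℝ} (hM : ‖(truncMatrix e L S)⁻¹‖ ≤ M) (c : ι → ℂ) :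
    ‖(WithLp.toLp 2 fun m : S => c m : EuclideanSpace ℂ S)‖ ≤
      M * ‖(WithLp.toLp 2 fun n : S => inner ℂ (L (e n)) (∑ m ∈ S, c m • e m) :
        EuclideanSpace ℂ S)‖ := by
  set A := truncMatrix e L S
  have h : (fun m : S => c m) =
      A⁻¹.conjTranspose.mulVec fun n : S => inner ℂ (L (e n)) (∑ m ∈ S, c m • e m) := by
    have h1 : (fun n : S => inner ℂ (L (e n)) (∑ m ∈ S, c m • e m)) =
        A.conjTranspose.mulVec fun m => c m :=
      funext fun n => (conjTranspose_truncMatrix_mulVec e L S c n).symm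
    rw [h1, Matrix.mulVec_mulVec, ← Matrix.conjTranspose_mul,
      Matrix.mul_nonsing_inv _ ((Matrix.isUnit_iff_isUnit_det _).1 hA),
      Matrix.conjTranspose_one, Matrix.one_mulVec]
  calc _ = ‖(WithLp.toLp 2 (A⁻¹.conjTranspose.mulVec
          fun n : S => inner ℂ (L (e n)) (∑ m ∈ S, c m • e m)) : EuclideanSpace ℂ S)‖ := by
        rw [← h]
    _ ≤ ‖A⁻¹.conjTranspose‖ * _ := Matrix.l2_opNorm_mulVec A⁻¹.conjTranspose
        (WithLp.toLp 2 fun n : S => inner ℂ (L (e n)) (∑ m ∈ S, c m • e m))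
    _ ≤ _ := by
        rw [Matrix.l2_opNorm_conjTranspose]
        gcongr

theorem norm_sum_smul_orthonormal {e : ι → H} (he : Orthonormal ℂ e) (S : Finset ι) (c : ι → ℂ) :
    ‖∑ m ∈ S, c m • e m‖ = ‖(WithLp.toLp 2 fun m : S => c m : EuclideanSpace ℂ S)‖ := by
  rw [EuclideanSpace.norm_eq, ← Real.sqrt_sq (norm_nonneg (∑ m ∈ S, c m • e m)),
    norm_sq_eq_re_inner (𝕜 := ℂ), he.inner_sum, ← Finset.sum_coe_sort S, map_sum]
  congr 1
  refine Finset.sum_congr rfl fun m _ => ?_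
  rw [RCLike.conj_mul, ← RCLike.ofReal_pow, RCLike.ofReal_re]

theorem norm_toLp_inner_le [CompleteSpace H] {e : ι → H} (he : Orthonormal ℂ e) (S : Finset ι)
    (x : H) : ‖(WithLp.toLp 2 fun m : S => inner ℂ (e m) x : EuclideanSpace ℂ S)‖ ≤ ‖x‖ := by
  rw [EuclideanSpace.norm_eq]
  refine Real.sqrt_le_iff.2 ⟨norm_nonneg _, ?_⟩
  exact (Finset.sum_coe_sort S fun m => ‖inner ℂ (e m) x‖ ^ 2).le.trans
    (he.sum_inner_products_le x)

/-- Convergence of the solutions of truncated systems whose right-hand sides are perturbed by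
bounded multipliers that converge to `1` pointwise. -/
theorem tendsto_sum_of_truncated_systems [DecidableEq ι] [CompleteSpace H] {α : Type*} {l : Filter α}
    (b : HilbertBasis ι ℂ H) (L : H ≃L[ℂ] H) {S : α → Finset ι} (hS : Tendsto S l atTop) {M : ℝ}
    (hA : ∀ a, IsUnit (truncMatrix b L (S a))) (hM : ∀ a, ‖(truncMatrix b L (S a))⁻¹‖ ≤ M)
    {s : α → ι → ℂ} (hs : ∀ a n, ‖s a n‖ ≤ 1) (hs' : ∀ n, Tendsto (fun a => s a n) l (𝓝 1))
    {F : H} {c : α → ι → ℂ}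
    (hc : ∀ a, ∀ n ∈ S a,
      inner ℂ (L (b n)) (∑ m ∈ S a, c a m • b m) = s a n * inner ℂ (L (b n)) F) :
    Tendsto (fun a => ∑ m ∈ S a, c a m • b m) l (𝓝 F) := by
  rcases l.eq_or_neBot with rfl | hl
  · exact tendsto_bot
  obtain ⟨a₀⟩ := hl.nonempty
  have hM0 : 0 ≤ M := (norm_nonneg _).trans (hM a₀)
  set P : α → H := fun a => ∑ m ∈ S a, inner ℂ (b m) F • b m with hPdef
  have hP : Tendsto P l (𝓝 F) := by
    have h := b.hasSum_repr F
    simp_rw [b.repr_apply_apply] at h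
    rw [HasSum, SummationFilter.unconditional_filter] at h
    exact h.comp hS
  set L' : H →L[ℂ] H := ContinuousLinearMap.adjoint (L : H →L[ℂ] H)
  have hL' : ∀ n x, inner ℂ (L (b n)) x = inner ℂ (b n) (L' x) := fun n x =>
    (ContinuousLinearMap.adjoint_inner_right (L : H →L[ℂ] H) (b n) x).symm
  -- The factor `4` is `2²`, from `‖s a n - 1‖ ≤ 2`; Bessel makes this the dominating series.
  have hsum : Summable fun n => 4 * ‖inner ℂ (b n) (L' F)‖ ^ 2 :=
    (b.orthonormal.inner_products_summable (L' F)).mul_left 4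
  have hbd : ∀ a n, ‖(s a n - 1) * inner ℂ (b n) (L' F)‖ ^ 2 ≤ 4 * ‖inner ℂ (b n) (L' F)‖ ^ 2 := by
    intro a n
    rw [norm_mul, mul_pow]
    have : ‖s a n - 1‖ ≤ 2 := (norm_sub_le _ _).trans (by rw [norm_one]; linarith [hs a n])
    gcongr
    nlinarith [norm_nonneg (s a n - 1)]
  set D : α → ℝ := fun a => ∑' n, ‖(s a n - 1) * inner ℂ (b n) (L' F)‖ ^ 2
  have hD : Tendsto D l (𝓝 0) := by
    have h := tendsto_tsum_of_dominated_convergence 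
      (f := fun a n => ‖(s a n - 1) * inner ℂ (b n) (L' F)‖ ^ 2) (g := fun _ => (0 : ℝ)) hsum
      (fun n => ?_) (show ∀ᶠ a in l, _ from Eventually.of_forall fun a n => ?_)
    · rwa [tsum_zero] at h
    · have h1 := ((hs' n).sub_const 1).mul_const (inner ℂ (b n) (L' F))
      simpa using (h1.norm).pow 2
    · rw [Real.norm_of_nonneg (by positivity)]
      exact hbd a n
  have key : ∀ a, ‖(∑ m ∈ S a, c a m • b m) - P a‖ ≤ M * (√(D a) + ‖L' (F - P a)‖) := by
    intro a
    -- The residual splits into the error of the multipliers and the error of truncating `F`.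
    have hpt : ∀ n ∈ S a, inner ℂ (L (b n)) ((∑ m ∈ S a, c a m • b m) - P a) =
        (s a n - 1) * inner ℂ (b n) (L' F) + inner ℂ (b n) (L' (F - P a)) := fun n hn => by
      rw [inner_sub_right, hc a n hn, ← hL', ← hL', inner_sub_right]
      ring
    obtain ⟨u, hu⟩ : ∃ u : ι → ℂ, (∑ m ∈ S a, c a m • b m) - P a = ∑ m ∈ S a, u m • b m :=
      ⟨fun m => c a m - inner ℂ (b m) F, by simp only [hPdef, ← Finset.sum_sub_distrib, sub_smul]⟩
    rw [hu] at hpt ⊢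
    rw [norm_sum_smul_orthonormal b.orthonormal]
    refine (norm_le_of_norm_inv_truncMatrix_le (hA a) (hM a) u).trans ?_
    have e2 : (WithLp.toLp 2 fun n : S a => inner ℂ (L (b n)) (∑ m ∈ S a, u m • b m) :
        EuclideanSpace ℂ (S a)) =
        (WithLp.toLp 2 fun n : S a => (s a n - 1) * inner ℂ (b n) (L' F)) +
          (WithLp.toLp 2 fun n : S a => inner ℂ (b n) (L' (F - P a))) := by
      rw [← WithLp.toLp_add]
      exact congrArg (WithLp.toLp 2) (funext fun n : S a => hpt n n.2)
    rw [e2]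
    gcongr
    refine (norm_add_le _ _).trans (add_le_add ?_ (norm_toLp_inner_le b.orthonormal _ _))
    rw [EuclideanSpace.norm_eq]
    refine Real.sqrt_le_sqrt ?_
    refine (Finset.sum_coe_sort (S a) fun n =>
      ‖(s a n - 1) * inner ℂ (b n) (L' F)‖ ^ 2).le.trans ?_
    exact (Summable.of_nonneg_of_le (fun _ => by positivity) (hbd a) hsum).sum_le_tsum _
      fun _ _ => by positivity
  have hlim : Tendsto (fun a => M * (√(D a) + ‖L' (F - P a)‖)) l (𝓝 0) := by
    have h1 : Tendsto (fun a => L' (F - P a)) l (𝓝 0) := by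
      have := (L'.continuous.tendsto _).comp ((tendsto_const_nhds (x := F)).sub hP)
      rwa [sub_self, map_zero] at this
    simpa using (((Real.continuous_sqrt.tendsto 0).comp hD).add h1.norm).const_mul M
  have h := (squeeze_zero_norm key hlim).add hP
  simpa using h

/-- An orthonormal family mapped to a Riesz basis by an isomorphism is complete. -/
theorem span_topologicalClosure_eq_top_of_isRieszBasis {e v : ι → H} {L : H ≃L[ℂ] H}
    (hL : ∀ n, L (e n) = v n) (hv : IsRieszBasis v) :
    (Submodule.span ℂ (Set.range e)).topologicalClosure = ⊤ := by
  obtain ⟨b, T, hT⟩ := hv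
  -- `L⁻¹ T` carries a Hilbert basis to `e`, and an isomorphism preserves density of the span.
  set Φ : H ≃L[ℂ] H := T.trans L.symm
  have hΦ : ∀ n, Φ (b n) = e n := fun n => by
    change L.symm (T (b n)) = e n
    rw [hT, ← hL, L.symm_apply_apply]
  have hb := Submodule.dense_iff_topologicalClosure_eq_top.2 b.dense_span
  have h := Φ.surjective.denseRange.dense_image Φ.continuous hb
  rw [← Submodule.dense_iff_topologicalClosure_eq_top]
  convert! h
  have : Set.range e = Φ '' Set.range b := by
    rw [← Set.range_comp]; congr 1; funext n; exact (hΦ n).symm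
  rw [this]
  exact congrArg SetLike.coe (Submodule.map_span (Φ : H →ₗ[ℂ] H) (Set.range b)).symm

end Truncation

/-! ### Interpolation -/

section Interpolation

variable {d : ℕ}

/-- The function in `L₂([-π,π]^d)` that corresponds to `Ψ(t) SINC(πt)/Q_{d,ℓ}(t)`. -/
def approxSpectrum (ℓ : ℕ) (p : MvPolynomial (Fin d) ℂ) : L2Cube d :=
  ∑ n ∈ box d ℓ, (evalAt p (intVec d n) * (SINCQuot d ℓ (intVec d n) : ℂ)) • expL2 d (intVec d n)

theorem evalAt_mul_SINCQuot {ℓ : ℕ} {p : MvPolynomial (Fin d) ℂ} (hp : ∀ i, p.degreeOf i ≤ 2 * ℓ)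
    (x : EuclideanSpace ℝ (Fin d)) :
    evalAt p x * (SINCQuot d ℓ x : ℂ) = inner ℂ (expL2 d x) (approxSpectrum ℓ p) := by
  have h : evalAt p x = ∑ n ∈ box d ℓ, evalAt p (intVec d n) * evalAt (gridLagr ℓ n) x := by
    conv_lhs => rw [eq_sum_gridLagr hp]
    simp only [evalAt, map_sum, map_mul, MvPolynomial.eval_C]
  rw [h, approxSpectrum, inner_sum, Finset.sum_mul]
  refine Finset.sum_congr rfl fun n hn => ?_
  rw [mul_assoc, evalAt_gridLagr_mul_SINCQuot hn, inner_smul_right, inner_expL2_expL2,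
    Complex.ofReal_mul, mul_assoc]
  rfl

variable {t : (Fin d → ℤ) → EuclideanSpace ℝ (Fin d)} {L : L2Cube d ≃L[ℂ] L2Cube d}

/-- The homogeneous truncated system forces the coefficients of `approxSpectrum ℓ p` to vanish.
Since `SINCQuot` is nonzero at the integer points of the box, `p` vanishes there, hence identically.
-/
theorem eq_zero_of_evalAt_eq_zero (hL : ∀ n, L (expL2 d (intVec d n)) = expL2 d (t n)) {ℓ : ℕ}
    (hA : IsUnit (truncMatrix (fun n => expL2 d (intVec d n)) L (box d ℓ)))
    {p : MvPolynomial (Fin d) ℂ} (hp : ∀ i, p.degreeOf i ≤ 2 * ℓ)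
    (h0 : ∀ n ∈ box d ℓ, evalAt p (t n) = 0) : p = 0 := by
  have h := norm_le_of_norm_inv_truncMatrix_le hA le_rfl
    fun n => evalAt p (intVec d n) * (SINCQuot d ℓ (intVec d n) : ℂ)
  have hz : ∀ n : box d ℓ, inner ℂ (L (expL2 d (intVec d n))) (approxSpectrum ℓ p) = 0 := fun n => by
    rw [hL, ← evalAt_mul_SINCQuot hp, h0 n n.2, zero_mul]
  simp only [approxSpectrum] at hz
  simp only [hz] at h
  have h1 := norm_le_zero_iff.1 (h.trans_eq (by rw [← Pi.zero_def, WithLp.toLp_zero, norm_zero, mul_zero]))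
  rw [eq_sum_gridLagr hp]
  refine Finset.sum_eq_zero fun n hn => ?_
  have h2 : evalAt p (intVec d n) * (SINCQuot d ℓ (intVec d n) : ℂ) = 0 :=
    congrFun (congrArg WithLp.ofLp h1) ⟨n, hn⟩
  rw [(mul_eq_zero.1 h2).resolve_right (by exact_mod_cast SINCQuot_intVec_ne_zero hn), map_zero,
    zero_mul]

theorem evalAt_sub (p q : MvPolynomial (Fin d) ℂ) (x : EuclideanSpace ℝ (Fin d)) :
    evalAt (p - q) x = evalAt p x - evalAt q x := map_sub _ _ _

theorem eq_of_evalAt_eq (hL : ∀ n, L (expL2 d (intVec d n)) = expL2 d (t n)) {ℓ : ℕ}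
    (hA : IsUnit (truncMatrix (fun n => expL2 d (intVec d n)) L (box d ℓ)))
    {p q : MvPolynomial (Fin d) ℂ} (hp : ∀ i, p.degreeOf i ≤ 2 * ℓ)
    (hq : ∀ i, q.degreeOf i ≤ 2 * ℓ)
    (h : ∀ n ∈ box d ℓ, evalAt p (t n) = evalAt q (t n)) : p = q := by
  refine sub_eq_zero.1 (eq_zero_of_evalAt_eq_zero hL hA (fun i => ?_) fun n hn => ?_)
  · exact (MvPolynomial.degreeOf_sub_le i p q).trans (max_le (hp i) (hq i))
  · rw [evalAt_sub, h n hn, sub_self]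

/-- Uniqueness makes the map from values on the integer box to values at the `t n` an injective
endomorphism of a finite-dimensional space, hence surjective. No division by `SINCQuot d ℓ (t n)`,
which may be zero, is needed. -/
theorem exists_evalAt_eq (hL : ∀ n, L (expL2 d (intVec d n)) = expL2 d (t n)) {ℓ : ℕ}
    (hA : IsUnit (truncMatrix (fun n => expL2 d (intVec d n)) L (box d ℓ)))
    (y : (Fin d → ℤ) → ℂ) :
    ∃ p : MvPolynomial (Fin d) ℂ, (∀ i, p.degreeOf i ≤ 2 * ℓ) ∧
      ∀ n ∈ box d ℓ, evalAt p (t n) = y n := by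
  let R : (box d ℓ → ℂ) →ₗ[ℂ] MvPolynomial (Fin d) ℂ :=
    ∑ n : box d ℓ, (LinearMap.proj n).smulRight (gridLagr ℓ n)
  have hR : ∀ c, R c = ∑ n : box d ℓ, MvPolynomial.C (c n) * gridLagr ℓ (n : Fin d → ℤ) := fun c => by
    simp [R, MvPolynomial.smul_eq_C_mul]
  have hdeg : ∀ c i, (R c).degreeOf i ≤ 2 * ℓ := fun c i => by
    rw [hR]
    refine (MvPolynomial.degreeOf_sum_le i _ _).trans (Finset.sup_le fun n _ => ?_)
    exact (MvPolynomial.degreeOf_C_mul_le _ _ _).trans (degreeOf_gridLagr_le n.2 i)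
  have heval : ∀ c (m : box d ℓ), evalAt (R c) (intVec d m) = c m := fun c m => by
    rw [hR, evalAt, map_sum, Finset.sum_eq_single m]
    · rw [map_mul, MvPolynomial.eval_C]
      change _ * evalAt (gridLagr ℓ (m : Fin d → ℤ)) (intVec d m) = _
      rw [evalAt_gridLagr_intVec m.2 m.2, if_pos rfl, mul_one]
    · intro n _ hnm
      rw [map_mul]
      change _ * evalAt (gridLagr ℓ (n : Fin d → ℤ)) (intVec d m) = _
      rw [evalAt_gridLagr_intVec n.2 m.2, if_neg (fun h => hnm (Subtype.ext h)), mul_zero]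
    · simp
  let T : (box d ℓ → ℂ) →ₗ[ℂ] (box d ℓ → ℂ) :=
    LinearMap.pi fun m => (MvPolynomial.aeval (R := ℂ) fun i => ((t m) i : ℂ)).toLinearMap ∘ₗ R
  have hT : ∀ c m, T c m = evalAt (R c) (t m) := fun c m => by
    simp [T, evalAt, MvPolynomial.aeval_eq_eval]
  have hinj : Function.Injective T := by
    rw [injective_iff_map_eq_zero]
    intro c hc
    have h0 : R c = 0 := eq_zero_of_evalAt_eq_zero hL hA (hdeg c) fun n hn => by
      rw [← hT c ⟨n, hn⟩, hc]; rfl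
    funext m
    rw [← heval c m, h0]
    simp [evalAt]
  obtain ⟨c, hc⟩ := LinearMap.injective_iff_surjective.1 hinj fun n => y n
  exact ⟨R c, hdeg c, fun n hn => by rw [← hT c ⟨n, hn⟩, hc]⟩

theorem evalAt_map_conj (p : MvPolynomial (Fin d) ℂ) (x : EuclideanSpace ℝ (Fin d)) :
    evalAt (p.map (starRingEnd ℂ)) x = (starRingEnd ℂ) (evalAt p x) := by
  rw [evalAt, evalAt, MvPolynomial.eval_map, MvPolynomial.eval, MvPolynomial.coe_eval₂Hom,
    MvPolynomial.hom_eval₂]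
  simp

/-- Conjugating the coefficients preserves the real values at the nodes, so by uniqueness it fixes
`p`. -/
theorem im_evalAt_eq_zero (hL : ∀ n, L (expL2 d (intVec d n)) = expL2 d (t n)) {ℓ : ℕ}
    (hA : IsUnit (truncMatrix (fun n => expL2 d (intVec d n)) L (box d ℓ)))
    {p : MvPolynomial (Fin d) ℂ} (hp : ∀ i, p.degreeOf i ≤ 2 * ℓ)
    (h : ∀ n ∈ box d ℓ, (evalAt p (t n)).im = 0) (x : EuclideanSpace ℝ (Fin d)) :
    (evalAt p x).im = 0 := by
  have e : p.map (starRingEnd ℂ) = p := by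
    refine eq_of_evalAt_eq hL hA (fun i => le_trans ?_ (hp i)) hp fun n hn => ?_
    · rw [MvPolynomial.degreeOf_eq_sup, MvPolynomial.degreeOf_eq_sup]
      exact Finset.sup_mono (MvPolynomial.support_map_subset _ _)
    · rw [evalAt_map_conj, Complex.conj_eq_iff_im.2 (h n hn)]
  rw [← Complex.conj_eq_iff_im, ← evalAt_map_conj, e]

theorem tendsto_box_atTop (d : ℕ) : Tendsto (fun ℓ : ℕ+ => box d ℓ) atTop atTop := by
  refine tendsto_atTop_finset_of_monotone (fun a b hab n hn => ?_) fun n => ?_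
  · have : (a : ℕ) ≤ b := hab
    rw [mem_box] at hn ⊢
    intro i
    have := hn i
    rw [Finset.mem_Icc] at this ⊢
    omega
  · refine ⟨⟨(∑ i, (n i).natAbs) + 1, by omega⟩, mem_box.2 fun i => ?_⟩
    have := Finset.single_le_sum (f := fun i => (n i).natAbs) (fun _ _ => Nat.zero_le _)
      (Finset.mem_univ i)
    rw [Finset.mem_Icc, PNat.mk_coe]
    omega

end Interpolation

end ExpInterp

end

theorem theorem4p1 (d : ℕ) (t : (Fin d → ℤ) → EuclideanSpace ℝ (Fin d))
    (ht : ExpInterp.IsUniformlyInvertibleRieszBasis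
      (fun n => ExpInterp.expL2 d (ExpInterp.intVec d n))
      (fun ℓ : ℕ+ => ExpInterp.box d ℓ)
      (fun n => ExpInterp.expL2 d (t n)))
    (f : EuclideanSpace ℝ (Fin d) → ℂ) (hf : f ∈ ExpInterp.PaleyWiener d) :
    ∃ Ψ : ℕ+ → MvPolynomial (Fin d) ℂ,
      ExpInterp.Interpolates t f Ψ ∧
      (∀ Ψ' : ℕ+ → MvPolynomial (Fin d) ℂ, ExpInterp.Interpolates t f Ψ' → Ψ' = Ψ) ∧
      ((∀ x, (f x).im = 0) → ∀ ℓ x, (ExpInterp.evalAt (Ψ ℓ) x).im = 0) ∧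
      (∀ ℓ, MemLp (ExpInterp.approximant Ψ ℓ) 2 volume) ∧
      Tendsto (fun ℓ => eLpNorm (fun x => ExpInterp.approximant Ψ ℓ x - f x) 2 volume)
        atTop (𝓝 0) ∧
      TendstoUniformly (ExpInterp.approximant Ψ) f atTop := by
  obtain ⟨hv, L, hL, hA, M, hM⟩ := ht
  obtain ⟨F, hF⟩ := ExpInterp.exists_eq_inner_expL2 hf
  choose Ψ hdeg hΨ using fun ℓ : ℕ+ => ExpInterp.exists_evalAt_eq hL (hA ℓ) fun n => f (t n)
  set G : ℕ+ → ExpInterp.L2Cube d := fun ℓ => ExpInterp.approxSpectrum ℓ (Ψ ℓ) with hGdef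
  have hap : ∀ ℓ x, ExpInterp.approximant Ψ ℓ x = inner ℂ (ExpInterp.expL2 d x) (G ℓ) :=
    fun ℓ x => ExpInterp.evalAt_mul_SINCQuot (hdeg ℓ) x
  have hsub : ∀ ℓ x, ExpInterp.approximant Ψ ℓ x - f x =
      inner ℂ (ExpInterp.expL2 d x) (G ℓ - F) := fun ℓ x => by
    rw [hap, hF, inner_sub_right]
  -- Completeness of the integer exponentials is inherited from the Riesz basis through `L`, with no
  -- separate density argument.
  let b : HilbertBasis (Fin d → ℤ) ℂ (ExpInterp.L2Cube d) :=
    HilbertBasis.mk (ExpInterp.orthonormal_expL2_intVec d)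
      (ExpInterp.span_topologicalClosure_eq_top_of_isRieszBasis hL hv).ge
  have hb : (b : (Fin d → ℤ) → ExpInterp.L2Cube d) =
      fun n => ExpInterp.expL2 d (ExpInterp.intVec d n) := HilbertBasis.coe_mk _ _
  have hG : Tendsto G atTop (𝓝 F) := by
    have h := ExpInterp.tendsto_sum_of_truncated_systems (l := atTop) (M := M) (F := F) b L
      (ExpInterp.tendsto_box_atTop d) (by rw [hb]; exact hA) (by rw [hb]; exact hM)
      (s := fun ℓ n => (ExpInterp.SINCQuot d ℓ (t n) : ℂ))
      (c := fun ℓ n => ExpInterp.evalAt (Ψ ℓ) (ExpInterp.intVec d n) *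
        (ExpInterp.SINCQuot d ℓ (ExpInterp.intVec d n) : ℂ)) (fun ℓ n => ?_) (fun n => ?_)
      (fun ℓ n hn => ?_)
    · rw [hb] at h
      exact h
    · rw [Complex.norm_real]
      exact ExpInterp.abs_SINCQuot_le_one _ _
    · have h := (ExpInterp.tendsto_SINCQuot (t n)).comp tendsto_PNat_val_atTop_atTop
      exact (Complex.continuous_ofReal.tendsto 1).comp h
    -- At `t n` the approximant is `f (t n) * SINCQuot d ℓ (t n)`, so the quotient itself is the
    -- multiplier in the truncated system.
    · rw [hb]
      simp only [hL]
      rw [← hF, ← hΨ ℓ n hn, mul_comm, ExpInterp.evalAt_mul_SINCQuot (hdeg ℓ)]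
      rfl
  have hG0 : Tendsto (fun ℓ => G ℓ - F) atTop (𝓝 0) := by
    simpa using hG.sub_const F
  refine ⟨Ψ, fun ℓ => ⟨hdeg ℓ, hΨ ℓ⟩, fun Ψ' h' => funext fun ℓ => ?_, fun hre ℓ x => ?_,
    fun ℓ => ?_, ?_, ?_⟩
  · refine ExpInterp.eq_of_evalAt_eq hL (hA ℓ) (h' ℓ).1 (hdeg ℓ) fun n hn => ?_
    rw [(h' ℓ).2 n hn, hΨ ℓ n hn]
  · refine ExpInterp.im_evalAt_eq_zero hL (hA ℓ) (hdeg ℓ) (fun n hn => ?_) x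
    rw [hΨ ℓ n hn, hre]
  · have : ExpInterp.approximant Ψ ℓ = fun x => inner ℂ (ExpInterp.expL2 d x) (G ℓ) :=
      funext (hap ℓ)
    rw [this]
    exact ExpInterp.memLp_inner_expL2 _
  · obtain ⟨K, hK, hle⟩ := ExpInterp.exists_eLpNorm_spectralFun_le d
    simp_rw [hsub, ExpInterp.eLpNorm_inner_expL2]
    have h1 : Tendsto (fun ℓ => K * ‖G ℓ - F‖ₑ) atTop (𝓝 0) := by
      have := ENNReal.Tendsto.const_mul (a := K) hG0.enorm (Or.inr hK)
      simpa using this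
    exact tendsto_of_tendsto_of_tendsto_of_le_of_le tendsto_const_nhds h1 (fun _ => zero_le)
      fun ℓ => hle _
  · rw [Metric.tendstoUniformly_iff]
    intro ε hε
    -- As the exponentials are unit vectors, Cauchy–Schwarz bounds the error at every `x` by `‖G ℓ -
    -- F‖`.
    filter_upwards [(Metric.tendsto_nhds.1 hG) ε hε] with ℓ hℓ x
    rw [dist_comm, dist_eq_norm, hsub]
    refine lt_of_le_of_lt (norm_inner_le_norm _ _) ?_
    rw [ExpInterp.norm_expL2, one_mul, ← dist_eq_norm]
    exact hℓ
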